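/- A hypergraph $\mathcal H=(V,H)$ is a nonempty set $V$ of vertices together with a collection $H$ of subsets of $V$, called hyperedges. Its theta complex $\Theta(\mathcal H)$ is the simplicial complex whose simplices are the nonempty finite sets of vertices contained in $V\setminus h$ for some hyperedge $h\in H$; it is identified with its geometric realization. Let $\operatorname{Cube}(n,k)$ be the hypergraph whose vertices are the $2^n$ vertices of the $n$-dimensional cube and whose hyperedges are the vertex sets of the $k$-dimensional faces of the cube. Let $S^d$ denote the unit sphere in $\mathbb R^{d+1}$ (so $S^{-1}=\emptyset$). Proposition. (1) For every integer $n\ge 1$, $\Theta(\operatorname{Cube}(n,n-1))$ is homotopy equivalent to $S^{n-1}$. (2) For every integer $n\ge 0$, $\Theta(\operatorname{Cube}(n,0))$ is homeomorphic to $S^{2^n-2}$. -/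

import Mathlib

/-- The theta complex of a hypergraph `H`: its simplices are the nonempty finite sets of vertices
that are contained in the complement (in the vertex set) of some hyperedge. -/
def Hypergraph.theta {α : Type*} (H : Hypergraph α) : PreAbstractSimplicialComplex α where
  faces := {s | s.Nonempty ∧ ∃ e ∈ H.edgeSet, (s : Set α) ⊆ H.vertexSet \ e}
  isRelLowerSet_faces := by
    rintro s ⟨hs, e, he, hse⟩
    refine ⟨hs, fun t hts ht => ⟨ht, e, he, ?_⟩⟩
    exact (Finset.coe_subset.mpr hts).trans hse

/-- The hypergraph `Cube(n, k)`. Its vertices are the vertices of the `n`-cube, that is, all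
`0`-`1` vectors of length `n`; its hyperedges are the vertex sets of the `k`-dimensional faces. Such
a face is given by a set `I` of `k` free coordinates, all other coordinates being fixed. -/
def Hypergraph.cube (n k : ℕ) : Hypergraph (Fin n → Bool) where
  vertexSet := Set.univ
  edgeSet := {e | ∃ (I : Finset (Fin n)) (a : Fin n → Bool),
    I.card = k ∧ e = {v | ∀ i, i ∉ I → v i = a i}}
  subset_vertexSet_of_mem_edgeSet' := fun _ _ => Set.subset_univ _

/-- The geometric realization of a simplicial complex on a finite set `ι`, as a subspace of `ℝ^ι`:
the points with barycentric coordinates supported on a simplex of the complex. -/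
def PreAbstractSimplicialComplex.realization {ι : Type*} [Fintype ι]
    (K : PreAbstractSimplicialComplex ι) : Set (ι → ℝ) :=
  {x | x ∈ stdSimplex ℝ ι ∧ ∃ s ∈ K.faces, ∀ i, i ∉ s → x i = 0}

/-! The complement of a facet of the cube is the opposite facet, so the simplices for `k = n - 1`
are the vertex sets lying in a common facet. Taking barycenters maps the realization to the boundary
of the cube. Product weights give a section `cubeWeights`, and both composites respect facets, so a
straight-line homotopy finishes (1). For `k = 0` the simplices are the nonempty proper vertex sets,
so the realization is the boundary of a simplex with `2 ^ n` vertices. Both boundaries are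
polyhedral, hence spheres. -/

open Set Bornology in
/-- The boundary of a bounded polyhedron with nonempty interior is homeomorphic to the unit
sphere. -/
theorem nonempty_homeomorph_polyhedron_boundary_sphere {E ι : Type*} [NormedAddCommGroup E]
    [NormedSpace ℝ E] [Finite ι] (l : ι → E →L[ℝ] ℝ) (b : ι → ℝ) {c : E}
    (hc : ∀ j, l j c < b j) (hb : IsBounded {x | ∀ j, l j x ≤ b j}) :
    Nonempty ({x | (∀ j, l j x ≤ b j) ∧ ∃ j, l j x = b j} ≃ₜ Metric.sphere (0 : E) 1) := by
  set s : Set E := {x | ∀ j, l j x ≤ b j} with hs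
  have hclosed : IsClosed s := by
    rw [hs, ofPred_forall]
    exact isClosed_iInter fun j => isClosed_le (l j).continuous continuous_const
  have hopen : IsOpen {x | ∀ j, l j x < b j} := by
    rw [ofPred_forall]
    exact isOpen_iInter_of_finite fun j => isOpen_lt (l j).continuous continuous_const
  have hconv : Convex ℝ s := by
    rw [hs, ofPred_forall]
    exact convex_iInter fun j => convex_halfSpace_le (l j).toLinearMap.isLinear (b j)
  have hint : interior s = {x | ∀ j, l j x < b j} := by
    refine Subset.antisymm (fun x hx j => ?_)
      (interior_maximal (fun x hx j => (hx j).le) hopen)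
    -- An interior point `x` can be pushed slightly away from `c` within `s`; as `l j c < b j`, this
    -- forces `l j x < b j`.
    have hcont : Filter.Tendsto (fun t : ℝ => x + t • (x - c)) (nhdsWithin 0 (Ioi 0)) (nhds x) := by
      have : Continuous fun t : ℝ => x + t • (x - c) := by fun_prop
      simpa using (this.tendsto 0).mono_left nhdsWithin_le_nhds
    obtain ⟨t, ht, ht0⟩ := ((hcont.eventually (mem_interior_iff_mem_nhds.mp hx)).and
      self_mem_nhdsWithin).exists
    have h1 := ht j
    have h2 := hc j
    have ht0 : 0 < t := ht0
    simp only [map_add, map_smul, map_sub, smul_eq_mul] at h1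
    nlinarith
  obtain ⟨h, -, -, hh⟩ := exists_homeomorph_image_interior_closure_frontier_eq_unitBall hconv
    ⟨c, by rw [hint]; exact hc⟩ hb
  have hfr : {x | (∀ j, l j x ≤ b j) ∧ ∃ j, l j x = b j} = frontier s := by
    rw [hclosed.frontier_eq, hint]
    ext x
    simp only [mem_ofPred_eq, mem_sdiff, not_forall, not_lt, hs]
    exact and_congr_right fun hx => exists_congr fun j => ⟨fun h => h.ge, fun h => (hx j).antisymm h⟩
  rw [hfr]
  exact ⟨(h.image _).trans (Homeomorph.setCongr hh)⟩

/-- The sign `1` or `-1` of a Boolean. -/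
def Bool.sign (b : Bool) : ℝ := if b then 1 else -1

theorem Bool.sign_mul_self (b : Bool) : b.sign * b.sign = 1 := by
  cases b <;> simp [Bool.sign]

theorem Bool.sign_of_ne {a b : Bool} (h : a ≠ b) : a.sign = -b.sign := by
  cases a <;> cases b <;> simp_all [Bool.sign]

/-- The boundary of the cube `[-1, 1]^n`. -/
def cubeBoundary (n : ℕ) : Set (EuclideanSpace ℝ (Fin n)) :=
  {y | (∀ p : Fin n × Bool, p.2.sign * y p.1 ≤ 1) ∧ ∃ p : Fin n × Bool, p.2.sign * y p.1 = 1}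

theorem nonempty_homeomorph_cubeBoundary_sphere (n : ℕ) :
    Nonempty (cubeBoundary n ≃ₜ Metric.sphere (0 : EuclideanSpace ℝ (Fin n)) 1) := by
  refine nonempty_homeomorph_polyhedron_boundary_sphere (c := 0)
    (fun p : Fin n × Bool => p.2.sign • EuclideanSpace.proj (𝕜 := ℝ) p.1) (fun _ => 1)
    (by simp) ?_
  refine (Metric.isBounded_closedBall (x := 0) (r := √n)).subset fun y hy => ?_
  rw [mem_closedBall_zero_iff, EuclideanSpace.norm_eq]
  refine Real.sqrt_le_sqrt ?_
  calc ∑ i, ‖y i‖ ^ 2 ≤ ∑ _i : Fin n, (1 : ℝ) := by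
        refine Finset.sum_le_sum fun i _ => ?_
        have h1 := hy (i, true)
        have h2 := hy (i, false)
        simp [Bool.sign] at h1 h2
        rw [Real.norm_eq_abs, sq_abs, sq_le_one_iff_abs_le_one, abs_le]
        constructor <;> linarith
    _ = n := by simp

theorem mem_realization_theta_cube_facets {n : ℕ} (hn : 1 ≤ n) {x : (Fin n → Bool) → ℝ} :
    x ∈ (Hypergraph.cube n (n - 1)).theta.realization ↔
      x ∈ stdSimplex ℝ (Fin n → Bool) ∧ ∃ p : Fin n × Bool, ∀ v, v p.1 ≠ p.2 → x v = 0 := by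
  refine and_congr_right fun _ => ⟨?_, ?_⟩
  · rintro ⟨s, ⟨-, _, ⟨I, a, hI, rfl⟩, hs⟩, hx⟩
    obtain ⟨i, hi⟩ : ∃ i, Iᶜ = {i} := by
      rw [← Finset.card_eq_one, Finset.card_compl, hI, Fintype.card_fin]
      omega
    refine ⟨(i, !a i), fun v hv => hx v fun hvs => (hs hvs).2 fun j hj => ?_⟩
    rw [← Finset.mem_compl, hi, Finset.mem_singleton] at hj
    subst hj
    simpa using hv
  · rintro ⟨⟨i, b⟩, hx⟩
    refine ⟨Finset.univ.filter fun v => v i = b, ⟨⟨fun _ => b, by simp⟩, _,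
      ⟨Finset.univ.erase i, fun _ => !b, by simp, rfl⟩, fun v hv => ?_⟩,
      fun v hv => hx v (by simpa using hv)⟩
    have hv : v i = b := by simpa using hv
    exact ⟨Set.mem_univ v, fun h => by simpa [hv] using h i (by simp)⟩

theorem Fintype.sum_prod_pi_apply {ι κ R : Type*} [Fintype ι] [DecidableEq ι] [Fintype κ]
    [CommSemiring R] (h : ι → κ → R) : ∑ v : ι → κ, ∏ i, h i (v i) = ∏ i, ∑ b, h i b := by
  rw [Finset.prod_univ_sum, Fintype.piFinset_univ]

/-- The point of the cube `[-1, 1]^n` with given barycentric coordinates in its vertices. -/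
noncomputable def cubeBarycenter {n : ℕ} (x : (Fin n → Bool) → ℝ) : EuclideanSpace ℝ (Fin n) :=
  WithLp.toLp 2 fun i => ∑ v, x v * (v i).sign

/-- The product barycentric coordinates of a point of the cube `[-1, 1]^n`. -/
noncomputable def cubeWeights {n : ℕ} (y : EuclideanSpace ℝ (Fin n)) (v : Fin n → Bool) : ℝ :=
  ∏ i, (1 + (v i).sign * y i) / 2

theorem continuous_cubeBarycenter {n : ℕ} : Continuous (cubeBarycenter (n := n)) := by
  unfold cubeBarycenter
  fun_prop

theorem continuous_cubeWeights {n : ℕ} : Continuous (cubeWeights (n := n)) := by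
  unfold cubeWeights
  fun_prop

theorem sum_cubeWeights {n : ℕ} (y : EuclideanSpace ℝ (Fin n)) : ∑ v, cubeWeights y v = 1 := by
  simp only [cubeWeights]
  rw [Fintype.sum_prod_pi_apply fun i (b : Bool) => (1 + b.sign * y i) / 2]
  refine Finset.prod_eq_one fun i _ => ?_
  simp [Bool.sign]
  ring

/-- The weights are the law of independent random signs with means `y i`, so their barycenter is
`y`. -/
theorem cubeBarycenter_cubeWeights {n : ℕ} (y : EuclideanSpace ℝ (Fin n)) :
    cubeBarycenter (cubeWeights y) = y := by
  ext i
  -- Absorbing the sign into the `i`-th factor lets the sum over vertices factor.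
  have h : ∀ v : Fin n → Bool, cubeWeights y v * (v i).sign =
      ∏ j, (1 + (v j).sign * y j) / 2 * (if j = i then (v j).sign else 1) := fun v => by
    rw [Finset.prod_mul_distrib, Finset.prod_ite_eq' Finset.univ i fun j => (v j).sign]
    simp [cubeWeights]
  simp only [cubeBarycenter, h]
  rw [Fintype.sum_prod_pi_apply fun j (b : Bool) =>
      (1 + b.sign * y j) / 2 * (if j = i then b.sign else 1),
    Finset.prod_eq_single i]
  · simp [Bool.sign]
    ring
  · intro j _ hj
    simp [Bool.sign, hj]
    ring
  · simp

/-- The second conjunct records that the facet `p` itself is preserved, as the homotopy requires. -/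
theorem cubeBarycenter_mem_cubeBoundary {n : ℕ} {x : (Fin n → Bool) → ℝ}
    (hx : x ∈ stdSimplex ℝ (Fin n → Bool)) {p : Fin n × Bool} (hp : ∀ v, v p.1 ≠ p.2 → x v = 0) :
    cubeBarycenter x ∈ cubeBoundary n ∧ p.2.sign * cubeBarycenter x p.1 = 1 := by
  have key : p.2.sign * cubeBarycenter x p.1 = 1 := by
    rw [cubeBarycenter, ← hx.2, PiLp.toLp_apply, Finset.mul_sum]
    refine Finset.sum_congr rfl fun v _ => ?_
    by_cases hv : v p.1 = p.2
    · rw [hv, mul_left_comm, Bool.sign_mul_self, mul_one]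
    · simp [hp v hv]
  refine ⟨⟨fun q => ?_, p, key⟩, key⟩
  rw [cubeBarycenter, ← hx.2, PiLp.toLp_apply, Finset.mul_sum]
  refine Finset.sum_le_sum fun v _ => ?_
  have h0 := hx.1 v
  cases q.2 <;> cases v q.1 <;> simp [Bool.sign] <;> linarith

theorem cubeWeights_mem_stdSimplex {n : ℕ} {y : EuclideanSpace ℝ (Fin n)}
    (hy : y ∈ cubeBoundary n) : cubeWeights y ∈ stdSimplex ℝ (Fin n → Bool) := by
  refine ⟨fun v => Finset.prod_nonneg fun i _ => ?_, sum_cubeWeights y⟩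
  have := hy.1 (i, !v i)
  rw [show (!v i).sign = -(v i).sign from Bool.sign_of_ne (by simp)] at this
  dsimp only at this
  linarith

theorem cubeWeights_eq_zero {n : ℕ} {y : EuclideanSpace ℝ (Fin n)} {p : Fin n × Bool}
    (hp : p.2.sign * y p.1 = 1) (v : Fin n → Bool) (hv : v p.1 ≠ p.2) : cubeWeights y v = 0 := by
  refine Finset.prod_eq_zero (Finset.mem_univ p.1) ?_
  rw [Bool.sign_of_ne hv]
  linarith

open unitInterval in
theorem nonempty_homotopyEquiv_theta_cube_facets {n : ℕ} (hn : 1 ≤ n) :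
    Nonempty (ContinuousMap.HomotopyEquiv
      ((Hypergraph.cube n (n - 1)).theta.realization) (cubeBoundary n)) := by
  have hf : ∀ x ∈ (Hypergraph.cube n (n - 1)).theta.realization,
      cubeBarycenter x ∈ cubeBoundary n := fun x hx => by
    obtain ⟨hx, p, hp⟩ := (mem_realization_theta_cube_facets hn).mp hx
    exact (cubeBarycenter_mem_cubeBoundary hx hp).1
  have hg : ∀ y ∈ cubeBoundary n,
      cubeWeights y ∈ (Hypergraph.cube n (n - 1)).theta.realization := fun y hy => by
    obtain ⟨p, hp⟩ := hy.2
    exact (mem_realization_theta_cube_facets hn).mpr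
      ⟨cubeWeights_mem_stdSimplex hy, p, cubeWeights_eq_zero hp⟩
  -- Both endpoints are supported on the vertices of one facet, so the segment between them is too.
  have hgf : ∀ (t : I), ∀ x ∈ (Hypergraph.cube n (n - 1)).theta.realization,
      (1 - t : ℝ) • cubeWeights (cubeBarycenter x) + (t : ℝ) • x ∈
        (Hypergraph.cube n (n - 1)).theta.realization := fun t x hx => by
    obtain ⟨hx, p, hp⟩ := (mem_realization_theta_cube_facets hn).mp hx
    obtain ⟨h1, h2⟩ := cubeBarycenter_mem_cubeBoundary hx hp
    refine (mem_realization_theta_cube_facets hn).mpr ⟨?_, p, fun v hv => ?_⟩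
    · exact convex_stdSimplex ℝ _ (cubeWeights_mem_stdSimplex h1) hx (sub_nonneg.mpr t.2.2) t.2.1
        (by ring)
    · simp [hp v hv, cubeWeights_eq_zero h2 v hv]
  have hcf := continuous_cubeBarycenter (n := n)
  have hcg := continuous_cubeWeights (n := n)
  refine ⟨⟨⟨fun x => ⟨cubeBarycenter x.1, hf _ x.2⟩, by fun_prop⟩,
    ⟨fun y => ⟨cubeWeights y.1, hg _ y.2⟩, by fun_prop⟩, ⟨?_⟩, ?_⟩⟩
  · exact
      { toFun := fun q => ⟨_, hgf q.1 q.2.1 q.2.2⟩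
        continuous_toFun := by fun_prop
        map_zero_left := fun x => Subtype.ext (by simp)
        map_one_left := fun x => Subtype.ext (by simp) }
  · convert ContinuousMap.Homotopic.refl _
    ext1 y
    exact (Subtype.ext (cubeBarycenter_cubeWeights y.1)).symm

theorem mem_realization_theta_cube_vertices {n : ℕ} {x : (Fin n → Bool) → ℝ} :
    x ∈ (Hypergraph.cube n 0).theta.realization ↔
      x ∈ stdSimplex ℝ (Fin n → Bool) ∧ ∃ v, x v = 0 := by
  refine and_congr_right fun hx => ⟨?_, ?_⟩
  · rintro ⟨s, ⟨-, _, ⟨I, a, hI, rfl⟩, hs⟩, hx⟩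
    refine ⟨a, hx a fun ha => (hs ha).2 fun _ _ => rfl⟩
  · rintro ⟨a, ha⟩
    refine ⟨Finset.univ.erase a, ⟨?_, _, ⟨∅, a, rfl, rfl⟩, fun v hv => ?_⟩, fun v hv => ?_⟩
    · obtain ⟨v, -, hv⟩ := Finset.exists_ne_zero_of_sum_ne_zero (hx.2.trans_ne one_ne_zero)
      exact ⟨v, by simpa using fun h : v = a => hv (h ▸ ha)⟩
    · exact ⟨Set.mem_univ v, fun h => by simp [show v = a from funext (by simpa using h)] at hv⟩
    · obtain rfl : v = a := by simpa using hv
      exact ha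

/-- The boundary of a simplex with `m + 1` vertices is a sphere in `m`-dimensional space. -/
theorem nonempty_homeomorph_stdSimplex_boundary_sphere {ι : Type*} [Fintype ι] {m : ℕ}
    (hm : Fintype.card ι = m + 1) :
    Nonempty ({x : ι → ℝ | x ∈ stdSimplex ℝ ι ∧ ∃ v, x v = 0} ≃ₜ
      Metric.sphere (0 : EuclideanSpace ℝ (Fin m)) 1) := by
  let e : ι ≃ Option (Fin m) := Fintype.equivOfCardEq (by simp [hm])
  have hsum (x : ι → ℝ) : ∑ v, x v = x (e.symm none) + ∑ i, x (e.symm (some i)) := by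
    rw [← e.symm.sum_comp, Fintype.sum_option]
  -- Dropping the coordinate of the vertex `none` gives the solid simplex `y i ≥ 0`, `∑ y i ≤ 1`;
  -- the index `none` is the facet where the dropped coordinate vanishes.
  let l : Option (Fin m) → EuclideanSpace ℝ (Fin m) →L[ℝ] ℝ := fun j =>
    j.elim (∑ i, EuclideanSpace.proj (𝕜 := ℝ) i) fun i => -EuclideanSpace.proj (𝕜 := ℝ) i
  let b : Option (Fin m) → ℝ := fun j => j.elim 1 fun _ => 0
  have hl0 (y) : l none y = ∑ i, y i := by simp [l]
  have hl1 (i y) : l (some i) y = -y i := by simp [l]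
  obtain ⟨h⟩ := nonempty_homeomorph_polyhedron_boundary_sphere l b
    -- The barycenter: its coordinates sum to `m / (m + 1) < 1`.
    (c := WithLp.toLp 2 fun _ => 1 / (m + 1 : ℝ)) (by
      rintro (_ | i)
      · rw [hl0]
        simp only [b, Finset.sum_const, Finset.card_univ, Fintype.card_fin, nsmul_eq_mul,
          Option.elim_none]
        rw [mul_one_div, div_lt_one (by positivity)]
        linarith
      · rw [hl1]
        simp only [b, Option.elim_some, neg_lt_zero]
        positivity) (by
      refine (Metric.isBounded_closedBall (x := 0) (r := √m)).subset fun y hy => ?_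
      rw [mem_closedBall_zero_iff, EuclideanSpace.norm_eq]
      refine Real.sqrt_le_sqrt ?_
      have hy0 (i) : 0 ≤ y i := by simpa [hl1, b] using hy (some i)
      have hy1 : ∑ i, y i ≤ 1 := by simpa [hl0, b] using hy none
      calc ∑ i, ‖y i‖ ^ 2 ≤ ∑ _i : Fin m, (1 : ℝ) := by
            refine Finset.sum_le_sum fun i _ => ?_
            rw [Real.norm_eq_abs, sq_abs]
            exact pow_le_one₀ (hy0 i)
              ((Finset.single_le_sum (fun j _ => hy0 j) (Finset.mem_univ i)).trans hy1)
        _ = m := by simp)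
  refine ⟨Homeomorph.trans ?_ h⟩
  let F : (ι → ℝ) → EuclideanSpace ℝ (Fin m) := fun x => WithLp.toLp 2 fun i => x (e.symm (some i))
  let G : EuclideanSpace ℝ (Fin m) → ι → ℝ := fun y v => (e v).elim (1 - ∑ i, y i) y
  have hF : Continuous F := by fun_prop
  have hG : Continuous G := by
    refine continuous_pi fun v => ?_
    simp only [G]
    cases e v <;> simp only [Option.elim] <;> fun_prop
  have hG0 (y) : G y (e.symm none) = 1 - ∑ i, y i := by simp [G]
  have hG1 (y i) : G y (e.symm (some i)) = y i := by simp [G]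
  refine
    { toFun := fun x => ⟨F x.1, ?_⟩
      invFun := fun y => ⟨G y.1, ?_⟩
      left_inv := fun x => Subtype.ext ?_
      right_inv := fun y => Subtype.ext ?_
      continuous_toFun := ?_
      continuous_invFun := ?_ }
  · obtain ⟨x, ⟨hx0, hx1⟩, v, hv⟩ := x
    rw [hsum] at hx1
    refine ⟨?_, e v, ?_⟩
    · rintro (_ | i)
      · simpa [hl0, b, F] using by linarith [hx0 (e.symm none)]
      · simpa [hl1, b, F] using hx0 _
    · obtain ⟨j, rfl⟩ := e.symm.surjective v
      rw [e.apply_symm_apply]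
      cases j
      · simpa [hl0, b, F] using by linarith
      · simpa [hl1, b, F] using hv
  · obtain ⟨y, hy, j, hj⟩ := y
    refine ⟨⟨fun v => ?_, ?_⟩, e.symm j, ?_⟩
    · obtain ⟨k, rfl⟩ := e.symm.surjective v
      have := hy k
      cases k
      · rw [hG0]
        simpa [hl0, b] using this
      · rw [hG1]
        simpa [hl1, b] using this
    · simp [hsum, hG0, hG1]
    · cases j
      · rw [hG0]
        simp only [hl0, b, Option.elim_none] at hj
        linarith
      · rw [hG1]
        simpa [hl1, b] using hj
  · obtain ⟨x, ⟨-, hx1⟩, -⟩ := x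
    rw [hsum] at hx1
    change G (F x) = x
    ext v
    obtain ⟨k, rfl⟩ := e.symm.surjective v
    cases k
    · rw [hG0]
      exact sub_eq_of_eq_add hx1.symm
    · rw [hG1]
  · ext i
    exact hG1 y.1 i
  · exact (hF.comp continuous_subtype_val).subtype_mk _
  · exact (hG.comp continuous_subtype_val).subtype_mk _

theorem mainTheorem9 (n : ℕ) :
    (1 ≤ n → Nonempty (ContinuousMap.HomotopyEquiv
      ((Hypergraph.cube n (n - 1)).theta.realization)
      (Metric.sphere (0 : EuclideanSpace ℝ (Fin n)) 1))) ∧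
    Nonempty (Homeomorph
      ((Hypergraph.cube n 0).theta.realization)
      (Metric.sphere (0 : EuclideanSpace ℝ (Fin (2 ^ n - 1))) 1)) := by
  constructor
  · intro hn
    obtain ⟨f⟩ := nonempty_homotopyEquiv_theta_cube_facets hn
    obtain ⟨h⟩ := nonempty_homeomorph_cubeBoundary_sphere n
    exact ⟨f.trans h.toHomotopyEquiv⟩
  · obtain ⟨h⟩ := nonempty_homeomorph_stdSimplex_boundary_sphere (ι := Fin n → Bool)
      (m := 2 ^ n - 1) (by simp [Nat.sub_add_cancel Nat.one_le_two_pow])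
    exact ⟨(Homeomorph.setCongr (Set.ext fun _ => mem_realization_theta_cube_vertices)).trans h⟩
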